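/- Let $R$ be a commutative Noetherian ring, $I \subseteq R$ an ideal, and $M$ an arbitrary $R$-module that is $I$-separated, i.e. $\bigcap_{\alpha \ge 0} I^{\alpha} M = 0$. Write $R_x$ for the localization of $R$ at the multiplicative set $\{x^{\alpha} : \alpha \ge 0\}$. Then the following conditions are equivalent: (i) $M$ is $I$-adically complete, i.e. the natural homomorphism $M \to \varprojlim_{\alpha} M/I^{\alpha}M$ is an isomorphism. (ii) $\operatorname{Ext}^i_R(F, M) = 0$ for all $i \ge 0$ and every flat $R$-module $F$ with $F \otimes_R R/I = 0$. (iii) $\operatorname{Ext}^1_R(R_x, M) = 0$ for all $x \in I$. (iv) $\operatorname{Ext}^1_R\left(\bigoplus_{i=1}^r R_{x_i}, M\right) = 0$ for some finite system of elements $x_1, \dots, x_r \in R$ with $\operatorname{Rad}\,(x_1, \dots, x_r)R = \operatorname{Rad} I$. (iv') $\operatorname{Ext}^1_R\left(\bigoplus_{i=1}^r R_{x_i}, M\right) = 0$ for every finite system of elements $x_1, \dots, x_r \in R$ with $\operatorname{Rad}\,(x_1, \dots, x_r)R = \operatorname{Rad} I$. -/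

import Mathlib

open scoped TensorProduct DirectSum

universe u

open CategoryTheory Abelian

/-! ### `Ext` vanishing as extension of linear maps. -/

section Ext

variable {R : Type u} [CommRing R] {K P F M : Type u} [AddCommGroup K] [Module R K]
  [AddCommGroup P] [Module R P] [AddCommGroup F] [Module R F] [AddCommGroup M] [Module R M]

/-! From `Ext` to completeness: since `R_x = R[X]/(xX - 1)`, vanishing of `Ext¹(R_x, M)` makes `y n
- x • y (n + 1) = m n` solvable for every sequence `m`, and `y 0` then serves as a sum of the series
`∑ x ^ n • m n` (`exists_forall_sub_sum_pow_smul`). A sparse subsequence of an `I`-adic Cauchy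
sequence telescopes into finitely many such series, so it converges.

From completeness to `Ext`: if `I F = F`, then `F` is trivially projective modulo every `I ^ n`. For
flat `F = P / K`, maps `K → M` therefore extend to `P` modulo each `I ^ n`, compatibly, and the
limit extends them into `M` (`exists_extension_of_isAdicComplete`). This kills `Ext¹`; dimension
shifting handles higher degrees. -/

/-- If `Ext¹(F, M) = 0`, then linear maps to `M` extend along the kernel of a surjection
onto `F`. -/
theorem exists_extension_of_subsingleton_ext_one {i : K →ₗ[R] P} {p : P →ₗ[R] F}
    (hi : Function.Injective i) (hip : Function.Exact i p) (hp : Function.Surjective p)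
    (hExt : Subsingleton (Ext (ModuleCat.of R F) (ModuleCat.of R M) 1)) (f : K →ₗ[R] M) :
    ∃ g : P →ₗ[R] M, g ∘ₗ i = f := by
  let S : ShortComplex (ModuleCat.{u} R) := ShortComplex.mk (ModuleCat.ofHom i)
    (ModuleCat.ofHom p) (by ext x; exact hip.apply_apply_eq_zero x)
  have hS : S.ShortExact := ModuleCat.shortComplex_shortExact S hip hi hp
  obtain ⟨x, hx⟩ := Ext.contravariant_sequence_exact₁ hS (ModuleCat.of R M)
    (Ext.mk₀ (ModuleCat.ofHom f)) (n₁ := 1) rfl (hExt.elim _ _)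
  obtain ⟨g, rfl⟩ := (Ext.mk₀_bijective _ _).surjective x
  rw [Ext.mk₀_comp_mk₀] at hx
  exact ⟨g.hom, congrArg ModuleCat.Hom.hom ((Ext.mk₀_bijective _ _).injective hx)⟩

theorem subsingleton_ext_one_of_forall_exists_extension [Module.Projective R P] {p : P →ₗ[R] F}
    (hp : Function.Surjective p)
    (h : ∀ f : p.ker →ₗ[R] M, ∃ g : P →ₗ[R] M, g ∘ₗ p.ker.subtype = f) :
    Subsingleton (Ext (ModuleCat.of R F) (ModuleCat.of R M) 1) := by
  have hS := LinearMap.shortExact_shortComplexKer hp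
  have : Projective (p.shortComplexKer.X₂) := inferInstanceAs (Projective (ModuleCat.of R P))
  refine subsingleton_of_forall_eq 0 fun x ↦ ?_
  obtain ⟨y, rfl⟩ := precomp_extClass_surjective_of_projective_X₂ (ModuleCat.of R M) hS 0 x
  obtain ⟨f, rfl⟩ := (Ext.mk₀_bijective _ _).surjective y
  obtain ⟨g, hg⟩ := h f.hom
  have hfg : f = p.shortComplexKer.f ≫ ModuleCat.ofHom g := by
    ext x
    exact (LinearMap.congr_fun hg x).symm
  rw [hfg, ← Ext.mk₀_comp_mk₀]
  exact hS.extClass_comp_assoc (Ext.mk₀ (ModuleCat.ofHom g)) (h := add_comm 1 0)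

theorem subsingleton_ext_succ_of_subsingleton_ext_ker [Module.Projective R P] {p : P →ₗ[R] F}
    (hp : Function.Surjective p) (n : ℕ)
    (h : Subsingleton (Ext (ModuleCat.of R p.ker) (ModuleCat.of R M) n)) :
    Subsingleton (Ext (ModuleCat.of R F) (ModuleCat.of R M) (n + 1)) := by
  have hS := LinearMap.shortExact_shortComplexKer hp
  have : Projective (p.shortComplexKer.X₂) := inferInstanceAs (Projective (ModuleCat.of R P))
  exact (precomp_extClass_surjective_of_projective_X₂ (ModuleCat.of R M) hS n).subsingleton

theorem subsingleton_ext_of_retract {n : ℕ} (i : F →ₗ[R] P) (p : P →ₗ[R] F)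
    (hpi : p ∘ₗ i = LinearMap.id)
    (h : Subsingleton (Ext (ModuleCat.of R P) (ModuleCat.of R M) n)) :
    Subsingleton (Ext (ModuleCat.of R F) (ModuleCat.of R M) n) := by
  refine subsingleton_of_forall_eq 0 fun x ↦ ?_
  have hid : ModuleCat.ofHom i ≫ ModuleCat.ofHom p = 𝟙 _ := by
    rw [← ModuleCat.ofHom_comp, hpi, ModuleCat.ofHom_id]
  rw [← Ext.mk₀_id_comp x, ← hid, ← Ext.mk₀_comp_mk₀_assoc,
    Subsingleton.elim ((Ext.mk₀ (ModuleCat.ofHom p)).comp x (zero_add n)) 0, Ext.comp_zero]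

end Ext

/-! ### Power series from `Ext¹` of a localization. -/

section Localization

open Polynomial

variable {R : Type u} [CommRing R]

theorem Polynomial.C_mul_X_sub_one_mem_nonZeroDivisors (x : R) :
    (C x * X - 1 : R[X]) ∈ nonZeroDivisors R[X] := by
  refine mem_nonzeroDivisors_of_coeff_mem 0 ?_
  have h0 : (C x * X - 1 : R[X]).coeff 0 = -1 := by simp
  rw [h0]
  exact isUnit_one.neg.mem_nonZeroDivisors

theorem exists_exact_mul_C_mul_X_sub_one (x : R) : ∃ p : R[X] →ₗ[R] Localization.Away x,
    Function.Surjective p ∧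
      Function.Exact (LinearMap.mulLeft R (C x * X - 1 : R[X])) p := by
  refine ⟨(Localization.awayEquivAdjoin x).symm.toLinearMap ∘ₗ
    (AdjoinRoot.mkₐ (C x * X - 1)).toLinearMap, ?_, fun f ↦ ?_⟩
  · exact (Localization.awayEquivAdjoin x).symm.surjective.comp AdjoinRoot.mk_surjective
  · change (Localization.awayEquivAdjoin x).symm (AdjoinRoot.mk (C x * X - 1) f) = 0 ↔ _
    rw [EmbeddingLike.map_eq_zero_iff, AdjoinRoot.mk_eq_zero]
    simp [dvd_def, eq_comm]

variable {M : Type u} [AddCommGroup M] [Module R M]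

theorem exists_sub_smul_succ_eq (x : R)
    (h : Subsingleton (Ext (ModuleCat.of R (Localization.Away x)) (ModuleCat.of R M) 1))
    (m : ℕ → M) : ∃ y : ℕ → M, ∀ n, y n - x • y (n + 1) = m n := by
  obtain ⟨p, hp, hex⟩ := exists_exact_mul_C_mul_X_sub_one x
  obtain ⟨g, hg⟩ := exists_extension_of_subsingleton_ext_one
    (fun a b hab ↦ (mul_cancel_left_mem_nonZeroDivisors
      (Polynomial.C_mul_X_sub_one_mem_nonZeroDivisors x)).mp hab) hex hp h
    -- The sign matches `(xX - 1) X ^ n = x X ^ (n + 1) - X ^ n`.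
    ((Polynomial.basisMonomials R).constr ℕ fun n ↦ - m n)
  refine ⟨fun n ↦ g (monomial n 1), fun n ↦ ?_⟩
  have := LinearMap.congr_fun hg (monomial n 1)
  rw [← congrFun (Polynomial.coe_basisMonomials R) n, Module.Basis.constr_basis] at this
  have h1 : (C x * X - 1 : R[X]) * monomial n 1 = x • monomial (n + 1) 1 - monomial n 1 := by
    rw [sub_mul, one_mul, mul_assoc, X_mul_monomial, smul_eq_C_mul]
  simp [h1] at this
  rw [← neg_inj, ← this]
  abel

theorem exists_forall_sub_sum_pow_smul (x : R)
    (h : Subsingleton (Ext (ModuleCat.of R (Localization.Away x)) (ModuleCat.of R M) 1))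
    (m : ℕ → M) :
    ∃ y : ℕ → M, ∀ N, y 0 - ∑ n ∈ Finset.range N, x ^ n • m n = x ^ N • y N := by
  obtain ⟨y, hy⟩ := exists_sub_smul_succ_eq x h m
  refine ⟨y, fun N ↦ ?_⟩
  induction N with
  | zero => simp
  | succ N ih =>
    rw [Finset.sum_range_succ, ← sub_sub, ih, ← hy, pow_succ, mul_smul, smul_sub]
    abel

end Localization

/-! ### Convergence of Cauchy sequences. -/

section Complete
variable {R : Type u} [CommRing R] {M : Type u} [AddCommGroup M] [Module R M]

theorem Submodule.exists_eq_sum_smul_of_mem_span_range_smul_top {ι : Type*} [Fintype ι]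
    (x : ι → R) {m : M} (hm : m ∈ Ideal.span (Set.range x) • (⊤ : Submodule R M)) :
    ∃ a : ι → M, m = ∑ i, x i • a i := by
  induction hm using Submodule.smul_induction_on' with
  | smul r hr m _ =>
    obtain ⟨c, rfl⟩ := Ideal.mem_span_range_iff_exists_fun.mp hr
    refine ⟨fun i ↦ c i • m, ?_⟩
    rw [Finset.sum_smul]
    exact Finset.sum_congr rfl fun i _ ↦ by rw [smul_smul, mul_comm]
  | add m _ m' _ h h' =>
    obtain ⟨a, rfl⟩ := h
    obtain ⟨a', rfl⟩ := h'
    exact ⟨a + a', by simp [Finset.sum_add_distrib]⟩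

theorem IsPrecomplete.of_forall_exists_sub_sum_pow_smul {I : Ideal R} (hI : I.FG) {r : ℕ}
    (x : Fin r → R) (hx : (Ideal.span (Set.range x)).radical = I.radical)
    (h : ∀ i (m : ℕ → M), ∃ y : ℕ → M,
      ∀ N, y 0 - ∑ n ∈ Finset.range N, x i ^ n • m n = x i ^ N • y N) :
    IsPrecomplete I M := by
  have hpow (n : ℕ) : ∃ k, I ^ k ≤ Ideal.span (Set.range fun i ↦ x i ^ n) := by
    refine Ideal.exists_pow_le_of_le_radical_of_fg ?_ hI
    have hle : (Ideal.span (Set.range x)).radical ≤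
        (Ideal.span (Set.range fun i ↦ x i ^ n)).radical := by
      rw [Ideal.radical_le_radical_iff, Ideal.span_le]
      rintro _ ⟨i, rfl⟩
      exact ⟨n, Ideal.subset_span ⟨i, rfl⟩⟩
    exact Ideal.le_radical.trans (hx.ge.trans hle)
  choose k hk using hpow
  obtain ⟨c, hc⟩ : ∃ c, Ideal.span (Set.range x) ^ c ≤ I :=
    Ideal.exists_pow_le_of_le_radical_of_fg (Ideal.le_radical.trans hx.le)
      (Submodule.fg_span (Set.finite_range x))
  refine ⟨fun f hf ↦ ?_⟩
  obtain ⟨K, hKmono, hkK⟩ : ∃ K : ℕ → ℕ, StrictMono K ∧ ∀ n, k n ≤ K n := by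
    refine ⟨fun n ↦ ∑ j ∈ Finset.range (n + 1), (k j + 1), strictMono_nat_of_lt_succ fun n ↦ ?_,
      fun n ↦ ?_⟩
    · rw [Finset.sum_range_succ _ (n + 1)]
      omega
    · dsimp only
      rw [Finset.sum_range_succ]
      omega
  have hdiff (n : ℕ) : ∃ a : Fin r → M, f (K (n + 1)) - f (K n) = ∑ i, x i ^ n • a i := by
    have h1 : f (K (n + 1)) - f (K n) ∈ I ^ K n • (⊤ : Submodule R M) :=
      SModEq.sub_mem.mp (hf (hKmono.monotone n.le_succ)).symm
    have h2 : I ^ K n • (⊤ : Submodule R M) ≤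
        Ideal.span (Set.range fun i ↦ x i ^ n) • (⊤ : Submodule R M) :=
      Submodule.smul_mono_left ((Ideal.pow_le_pow_right (hkK n)).trans (hk n))
    have h3 := h2 h1
    exact Submodule.exists_eq_sum_smul_of_mem_span_range_smul_top _ h3
  choose a ha using hdiff
  choose y hy using fun i ↦ h i fun n ↦ a n i
  have hsum (N : ℕ) : f (K N) = f (K 0) + ∑ i, ∑ n ∈ Finset.range N, x i ^ n • a n i := by
    rw [Finset.sum_comm]
    simp_rw [← ha]
    rw [Finset.sum_range_sub (fun n ↦ f (K n))]
    abel
  have hlim (N : ℕ) : f (K 0) + ∑ i, y i 0 - f (K N) = ∑ i, x i ^ N • y i N := by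
    rw [hsum N, add_sub_add_left_eq_sub, ← Finset.sum_sub_distrib]
    exact Finset.sum_congr rfl fun i _ ↦ hy i N
  refine ⟨f (K 0) + ∑ i, y i 0, fun n ↦ ?_⟩
  -- As `x i ^ (c + 1) ∈ I`, the error at index `(c + 1) * n` lies in `I ^ n M`. Using `c + 1` keeps
  -- the bound valid when `c = 0`.
  have hn : n ≤ K ((c + 1) * n) := (Nat.le_mul_of_pos_left n c.succ_pos).trans (hKmono.id_le _)
  refine (hf hn).trans (SModEq.symm (SModEq.sub_mem.mpr ?_))
  rw [hlim]
  refine Submodule.sum_mem _ fun i _ ↦ Submodule.smul_mem_smul ?_ Submodule.mem_top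
  have : x i ^ (c + 1) ∈ I :=
    hc (Ideal.pow_le_pow_right c.le_succ (Ideal.pow_mem_pow (Ideal.subset_span (Set.mem_range_self i)) _))
  rw [pow_mul]
  exact Ideal.pow_mem_pow this n

end Complete

/-! ### Flat modules that are projective modulo powers of an ideal. -/

section Lifting
variable {R : Type u} [CommRing R]

/-- `F` has the lifting property with respect to surjections whose source is killed by `J`.
Equivalently, `F ⧸ J F` is a projective `R ⧸ J`-module. -/
def Module.IsProjectiveMod (J : Ideal R) (F : Type u) [AddCommGroup F] [Module R F] : Prop :=
  ∀ (A B : Type u) [AddCommGroup A] [Module R A] [AddCommGroup B] [Module R B]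
    (π : A →ₗ[R] B), Function.Surjective π → J • (⊤ : Submodule R A) = ⊥ →
    ∀ g : F →ₗ[R] B, ∃ h : F →ₗ[R] A, π ∘ₗ h = g

variable {P F M : Type u} [AddCommGroup P] [Module R P] [AddCommGroup F] [Module R F]
  [AddCommGroup M] [Module R M]

theorem LinearMap.smul_top_eq_bot_of_surjective {J : Ideal R} {π : P →ₗ[R] F}
    (hπ : Function.Surjective π) (hP : J • (⊤ : Submodule R P) = ⊥) :
    J • (⊤ : Submodule R F) = ⊥ := by
  rw [← LinearMap.range_eq_top.mpr hπ, LinearMap.range_eq_map, ← Submodule.map_smul'', hP,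
    Submodule.map_bot]

theorem Submodule.smul_top_quotient_eq_bot (J : Ideal R) (M : Type u) [AddCommGroup M]
    [Module R M] : J • (⊤ : Submodule R (M ⧸ (J • (⊤ : Submodule R M)))) = ⊥ := by
  rw [← Submodule.range_mkQ, LinearMap.range_eq_map, ← Submodule.map_smul'',
    Submodule.mkQ_map_self]

theorem LinearMap.eq_zero_of_smul_top_eq_bot {J : Ideal R}
    (hF : J • (⊤ : Submodule R F) = ⊤) (hM : J • (⊤ : Submodule R M) = ⊥) (g : F →ₗ[R] M) :
    g = 0 := by
  rw [← LinearMap.range_eq_bot, LinearMap.range_eq_map, ← hF, Submodule.map_smul'', eq_bot_iff,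
    ← hM]
  exact Submodule.smul_mono le_rfl le_top

theorem Module.IsProjectiveMod.of_smul_top_eq_top {J : Ideal R}
    (hF : J • (⊤ : Submodule R F) = ⊤) : Module.IsProjectiveMod J F := by
  intro A B _ _ _ _ π hπ hA g
  have hB := LinearMap.smul_top_eq_bot_of_surjective hπ hA
  exact ⟨0, by rw [LinearMap.eq_zero_of_smul_top_eq_bot hF hB g, LinearMap.comp_zero]⟩

/-- For an ideal `J`, flatness of `F` and of `P` makes `J ⊗ K → J ⊗ P → R ⊗ P` injective, and this
composite factors through `J ⊗ K → R ⊗ K`. -/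
theorem Module.Flat.ker_of_surjective [Module.Flat R P] [Module.Flat R F] {p : P →ₗ[R] F}
    (hp : Function.Surjective p) : Module.Flat R p.ker := by
  rw [Module.Flat.iff_rTensor_injective']
  intro J
  have h1 := LinearMap.lTensor_injective_of_exact_of_flat p hp p.ker.subtype
    p.ker.injective_subtype p.exact_subtype_ker_map J
  have h2 := Module.Flat.iff_rTensor_injective'.mp (‹Module.Flat R P›) J
  have h3 := h2.comp h1
  rw [← LinearMap.coe_comp, LinearMap.rTensor_comp_lTensor, ← LinearMap.lTensor_comp_rTensor,
    LinearMap.coe_comp] at h3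
  exact h3.of_comp

variable {J : Ideal R} {p : P →ₗ[R] F}

/-- If `F` is flat and projective modulo `J`, then the inclusion of the kernel `K` of a
surjection `P → F` splits modulo `J`. -/
theorem Module.IsProjectiveMod.exists_comp_subtype_eq_mkQ [Module.Flat R F]
    (hF : Module.IsProjectiveMod J F) (hp : Function.Surjective p) :
    ∃ ρ : P →ₗ[R] p.ker ⧸ (J • (⊤ : Submodule R p.ker)),
      ρ ∘ₗ p.ker.subtype = Submodule.mkQ _ := by
  have hmap : (J • (⊤ : Submodule R P)).map p = J • (⊤ : Submodule R F) := by
    rw [Submodule.map_smul'', Submodule.map_top, LinearMap.range_eq_top.mpr hp]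
  let q : (P ⧸ (J • (⊤ : Submodule R P))) →ₗ[R] F ⧸ (J • (⊤ : Submodule R F)) :=
    Submodule.mapQ _ _ p (Submodule.map_le_iff_le_comap.mp hmap.le)
  have hq : Function.Surjective q := by
    intro z
    obtain ⟨z, rfl⟩ := Submodule.mkQ_surjective _ z
    obtain ⟨w, rfl⟩ := hp z
    exact ⟨Submodule.mkQ _ w, rfl⟩
  obtain ⟨s, hs⟩ := hF _ _ q hq (Submodule.smul_top_quotient_eq_bot J P) (Submodule.mkQ _)
  let j : (p.ker ⧸ (J • (⊤ : Submodule R p.ker))) →ₗ[R] P ⧸ (J • (⊤ : Submodule R P)) :=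
    Submodule.mapQ _ _ p.ker.subtype (by
      rw [← Submodule.map_le_iff_le_comap, Submodule.map_smul'']
      exact Submodule.smul_mono le_rfl le_top)
  have hj : Function.Injective j := by
    rw [injective_iff_map_eq_zero]
    intro z hz
    obtain ⟨z, rfl⟩ := Submodule.mkQ_surjective _ z
    have hz' : (z : P) ∈ J • (⊤ : Submodule R P) := (Submodule.Quotient.mk_eq_zero _).mp hz
    -- Flatness of `F` gives `K ∩ J P = J K`.
    have hz'' : (z : P) ∈ J • p.ker := by
      rw [← LinearMap.ker_inf_smul_top_eq_smul_of_flat J p hp]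
      exact ⟨z.2, hz'⟩
    exact (Submodule.Quotient.mk_eq_zero _).mpr ((Submodule.mem_smul_top_iff J p.ker z).mpr hz'')
  -- Subtracting the lift `s` pushes the projection into `ker q`, which is the image of `K / J K`.
  let φ : P →ₗ[R] P ⧸ (J • (⊤ : Submodule R P)) := Submodule.mkQ _ - s ∘ₗ p
  have hφ (w : P) : φ w ∈ j.range := by
    have h0 : q (φ w) = 0 := by
      have : q (s (p w)) = Submodule.mkQ _ (p w) := LinearMap.congr_fun hs (p w)
      rw [LinearMap.sub_apply, map_sub, LinearMap.comp_apply, this, sub_eq_zero]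
      rfl
    obtain ⟨v, hv⟩ := Submodule.mkQ_surjective _ (φ w)
    rw [← hv] at h0 ⊢
    have hv' : p v ∈ J • (⊤ : Submodule R F) := (Submodule.Quotient.mk_eq_zero _).mp h0
    rw [← hmap] at hv'
    obtain ⟨t, ht, htv⟩ := hv'
    refine ⟨Submodule.mkQ _ ⟨v - t, by simp [htv]⟩, ?_⟩
    change Submodule.Quotient.mk (v - t) = Submodule.Quotient.mk v
    rw [Submodule.Quotient.eq]
    simpa using ht
  refine ⟨(LinearEquiv.ofInjective j hj).symm.toLinearMap ∘ₗ φ.codRestrict _ hφ, ?_⟩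
  ext z
  apply (LinearEquiv.ofInjective j hj).injective
  apply Subtype.ext
  simp [φ, j]

theorem Module.IsProjectiveMod.exists_extension [Module.Flat R F]
    (hF : Module.IsProjectiveMod J F) (hp : Function.Surjective p)
    (hM : J • (⊤ : Submodule R M) = ⊥) (f : p.ker →ₗ[R] M) :
    ∃ g : P →ₗ[R] M, g ∘ₗ p.ker.subtype = f := by
  obtain ⟨ρ, hρ⟩ := hF.exists_comp_subtype_eq_mkQ hp
  have hle : J • (⊤ : Submodule R p.ker) ≤ f.ker := by
    rw [LinearMap.le_ker_iff_map, Submodule.map_smul'', eq_bot_iff, ← hM]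
    exact Submodule.smul_mono le_rfl le_top
  refine ⟨Submodule.liftQ _ f hle ∘ₗ ρ, ?_⟩
  rw [LinearMap.comp_assoc, hρ, Submodule.liftQ_mkQ]

theorem Module.IsProjectiveMod.ker [Module.Flat R F] [Module.Projective R P]
    (hF : Module.IsProjectiveMod J F) (hp : Function.Surjective p) :
    Module.IsProjectiveMod J p.ker := by
  intro A B _ _ _ _ π hπ hA g
  have hB := LinearMap.smul_top_eq_bot_of_surjective hπ hA
  obtain ⟨g', rfl⟩ := hF.exists_extension hp hB g
  obtain ⟨h, rfl⟩ := Module.projective_lifting_property π g' hπ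
  exact ⟨h ∘ₗ p.ker.subtype, rfl⟩

theorem exists_extension_of_isAdicComplete {I : Ideal R} [IsAdicComplete I M] [Module.Flat R F]
    (hF : ∀ n : ℕ, Module.IsProjectiveMod (I ^ n) F) (hp : Function.Surjective p)
    (f : p.ker →ₗ[R] M) : ∃ g : P →ₗ[R] M, g ∘ₗ p.ker.subtype = f := by
  let T (n : ℕ) : Submodule R M := I ^ n • ⊤
  let E (n : ℕ) := {g : P →ₗ[R] M ⧸ T n // g ∘ₗ p.ker.subtype = (T n).mkQ ∘ₗ f}
  have hstep (n : ℕ) (g : E n) :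
      ∃ g' : E (n + 1), Submodule.factorPow I M n.le_succ ∘ₗ g'.1 = g.1 := by
    obtain ⟨g₁, hg₁⟩ := (hF (n + 1)).exists_extension hp
      (Submodule.smul_top_quotient_eq_bot (I ^ (n + 1)) M) ((T (n + 1)).mkQ ∘ₗ f)
    let τ : (M ⧸ T (n + 1)) →ₗ[R] M ⧸ T n := Submodule.factorPow I M n.le_succ
    have hτ : τ ∘ₗ (T (n + 1)).mkQ = (T n).mkQ := rfl
    have hτs : Function.Surjective τ := Submodule.factor_surjective _
    -- An arbitrary extension `g₁` at level `n + 1` need not reduce to `g`, but the discrepancy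
    -- vanishes on `K`. It descends to `F`, lifts through `τ`, and corrects `g₁` without changing it
    -- on `K`.
    have hd : p.ker ≤ (g.1 - τ ∘ₗ g₁).ker := by
      intro z hz
      have e1 := LinearMap.congr_fun g.2 ⟨z, hz⟩
      have e2 := congrArg τ (LinearMap.congr_fun hg₁ ⟨z, hz⟩)
      simp only [LinearMap.comp_apply, Submodule.subtype_apply] at e1 e2
      rw [LinearMap.mem_ker, LinearMap.sub_apply, LinearMap.comp_apply, e1, e2]
      exact sub_self _
    let d : F →ₗ[R] M ⧸ T n :=
      p.ker.liftQ (g.1 - τ ∘ₗ g₁) hd ∘ₗ (p.quotKerEquivOfSurjective hp).symm.toLinearMap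
    have hdp : d ∘ₗ p = g.1 - τ ∘ₗ g₁ := by
      ext z
      have : (p.quotKerEquivOfSurjective hp).symm (p z) = Submodule.Quotient.mk z := by
        rw [LinearEquiv.symm_apply_eq]; rfl
      simp [d, this]
    obtain ⟨e, he⟩ := hF (n + 1) _ _ τ hτs
      (Submodule.smul_top_quotient_eq_bot (I ^ (n + 1)) M) d
    refine ⟨⟨g₁ + e ∘ₗ p, ?_⟩, ?_⟩
    · rw [LinearMap.add_comp, LinearMap.comp_assoc, LinearMap.comp_ker_subtype,
        LinearMap.comp_zero, add_zero]
      exact hg₁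
    · change τ ∘ₗ (g₁ + e ∘ₗ p) = g.1
      rw [LinearMap.comp_add, ← LinearMap.comp_assoc, he, hdp]
      abel
  obtain ⟨g₀, hg₀⟩ := (hF 0).exists_extension hp
    (Submodule.smul_top_quotient_eq_bot (I ^ 0) M) ((T 0).mkQ ∘ₗ f)
  choose next hnext using hstep
  let G (n : ℕ) : E n := Nat.rec ⟨g₀, hg₀⟩ next n
  have hG {n : ℕ} : Submodule.factorPow I M n.le_succ ∘ₗ (G (n + 1)).1 = (G n).1 :=
    hnext n (G n)
  let L : P →ₗ[R] M := IsAdicComplete.StrictMono.lift I strictMono_id (fun n ↦ (G n).1) hG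
  have hL (n : ℕ) : (T n).mkQ ∘ₗ L = (G n).1 :=
    IsAdicComplete.StrictMono.mkQ_comp_lift I strictMono_id (fun n ↦ (G n).1) hG
  refine ⟨L, DFunLike.coe_injective <| IsHausdorff.funext I fun n z ↦ ?_⟩
  have h1 := LinearMap.congr_fun (hL n) z
  have h2 := LinearMap.congr_fun (G n).2 z
  exact h1.trans h2

end Lifting

/-! ### `Ext` into a complete module. -/

section ExtOfComplete

variable {R : Type u} [CommRing R] {I : Ideal R} {M : Type u} [AddCommGroup M] [Module R M]

/-- Projectivity modulo `I ^ n` passes to syzygies, whereas `I F = F` does not; hence the weaker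
hypothesis in the induction. -/
theorem subsingleton_ext_succ_of_isAdicComplete [IsAdicComplete I M] (i : ℕ) (F : Type u)
    [AddCommGroup F] [Module R F] [Module.Flat R F]
    (hF : ∀ n : ℕ, Module.IsProjectiveMod (I ^ n) F) :
    Subsingleton (Ext (ModuleCat.of R F) (ModuleCat.of R M) (i + 1)) := by
  have hp : Function.Surjective (Finsupp.linearCombination R (id : F → F)) :=
    Finsupp.linearCombination_surjective R Function.surjective_id
  induction i generalizing F with
  | zero =>
    exact subsingleton_ext_one_of_forall_exists_extension hp
      (exists_extension_of_isAdicComplete hF hp)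
  | succ i ih =>
    have := Module.Flat.ker_of_surjective hp
    exact subsingleton_ext_succ_of_subsingleton_ext_ker hp _
      (ih _ (fun n ↦ (hF n).ker hp) (Finsupp.linearCombination_surjective R Function.surjective_id))

theorem Ideal.pow_smul_top_eq_top {F : Type u} [AddCommGroup F] [Module R F]
    (hF : I • (⊤ : Submodule R F) = ⊤) (n : ℕ) : I ^ n • (⊤ : Submodule R F) = ⊤ := by
  induction n with
  | zero => simp
  | succ n ih => rw [pow_succ, Submodule.mul_smul, hF, ih]

theorem subsingleton_ext_of_isAdicComplete [IsAdicComplete I M] (i : ℕ) (F : Type u)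
    [AddCommGroup F] [Module R F] [Module.Flat R F] (hF : I • (⊤ : Submodule R F) = ⊤) :
    Subsingleton (Ext (ModuleCat.of R F) (ModuleCat.of R M) i) := by
  cases i with
  | zero =>
    refine (Ext.addEquiv₀ (X := ModuleCat.of R F) (Y := ModuleCat.of R M)).subsingleton_congr.mpr
      (subsingleton_of_forall_eq 0 fun f ↦ ?_)
    ext x
    refine IsHausdorff.haus (I := I) inferInstance _ fun n ↦ SModEq.zero.mpr ?_
    -- Every map `F → M` lands in all `I ^ n M`, whose intersection is zero.
    have hx : x ∈ I ^ n • (⊤ : Submodule R F) := by simp [Ideal.pow_smul_top_eq_top hF n]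
    have hfx := Submodule.mem_map_of_mem (f := f.hom) hx
    rw [Submodule.map_smul''] at hfx
    exact Submodule.smul_mono le_rfl le_top hfx
  | succ i =>
    exact subsingleton_ext_succ_of_isAdicComplete i F fun n ↦
      Module.IsProjectiveMod.of_smul_top_eq_top (Ideal.pow_smul_top_eq_top hF n)

theorem Ideal.smul_top_eq_top_of_subsingleton_tensorProduct {F : Type u} [AddCommGroup F]
    [Module R F] (h : Subsingleton (F ⊗[R] (R ⧸ I))) : I • (⊤ : Submodule R F) = ⊤ := by
  rw [← Submodule.Quotient.subsingleton_iff]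
  exact (TensorProduct.tensorQuotEquivQuotSMul F I).symm.injective.subsingleton

/-- Some power of `x` acts invertibly on `R_x` and as zero on `R / I`. -/
theorem Localization.Away.subsingleton_tensorProduct_quotient {x : R} (hx : x ∈ I.radical) :
    Subsingleton (Localization.Away x ⊗[R] (R ⧸ I)) := by
  obtain ⟨n, hn⟩ := hx
  obtain ⟨u, hu⟩ := (IsLocalization.Away.algebraMap_isUnit (S := Localization.Away x) x).pow n
  refine subsingleton_of_forall_eq 0 fun z ↦ ?_
  induction z with
  | zero => rfl
  | add a b ha hb => rw [ha, hb, add_zero]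
  | tmul a b =>
    have h1 : a = x ^ n • ((↑u⁻¹ : Localization.Away x) * a) := by
      rw [Algebra.smul_def, map_pow, ← hu, Units.mul_inv_cancel_left]
    have h2 : x ^ n • b = 0 := by
      obtain ⟨b, rfl⟩ := Ideal.Quotient.mk_surjective b
      rw [← Ideal.Quotient.mk_eq_mk, ← Submodule.Quotient.mk_smul,
        Submodule.Quotient.mk_eq_zero, smul_eq_mul]
      exact I.mul_mem_right b hn
    rw [h1, TensorProduct.smul_tmul, h2, TensorProduct.tmul_zero]

end ExtOfComplete

theorem theorem1p1 (R : Type u) [CommRing R] [IsNoetherianRing R] (I : Ideal R)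
    (M : Type u) [AddCommGroup M] [Module R M]
    (hM : (⨅ n : ℕ, I ^ n • (⊤ : Submodule R M)) = ⊥) :
    List.TFAE [
      -- (i) `M` is `I`-adically complete: the natural map to `lim M / I ^ n M` is an isomorphism
      Function.Bijective (AdicCompletion.of I M),
      -- (ii) all `Ext` from flat modules `F` with `F ⊗ R / I = 0` vanish
      ∀ (i : ℕ) (F : Type u) [AddCommGroup F] [Module R F],
        Module.Flat R F → Subsingleton (F ⊗[R] (R ⧸ I)) →
          Subsingleton (CategoryTheory.Abelian.Ext (ModuleCat.of R F) (ModuleCat.of R M) i),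
      -- (iii) `Ext¹` from `R_x` vanishes for all `x ∈ I`
      ∀ x ∈ I, Subsingleton (CategoryTheory.Abelian.Ext
        (ModuleCat.of R (Localization.Away x)) (ModuleCat.of R M) 1),
      -- (iv) for some finite system generating `I` up to radical
      ∃ (r : ℕ) (x : Fin r → R), (Ideal.span (Set.range x)).radical = I.radical ∧
        Subsingleton (CategoryTheory.Abelian.Ext
          (ModuleCat.of R (⨁ i, Localization.Away (x i))) (ModuleCat.of R M) 1),
      -- (iv) for every finite system generating `I` up to radical
      ∀ (r : ℕ) (x : Fin r → R), (Ideal.span (Set.range x)).radical = I.radical →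
        Subsingleton (CategoryTheory.Abelian.Ext
          (ModuleCat.of R (⨁ i, Localization.Away (x i))) (ModuleCat.of R M) 1)] := by
  have hhaus : IsHausdorff I M := ⟨fun x hx ↦ by
    rw [← Submodule.mem_bot R, ← hM, Submodule.mem_iInf]
    exact fun n ↦ SModEq.zero.mp (hx n)⟩
  have hfg : I.FG := IsNoetherian.noetherian I
  have hcomplete {r : ℕ} (x : Fin r → R)
      (hx : (Ideal.span (Set.range x)).radical = I.radical)
      (hExt : ∀ i, Subsingleton (CategoryTheory.Abelian.Ext
        (ModuleCat.of R (Localization.Away (x i))) (ModuleCat.of R M) 1)) :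
      Function.Bijective (AdicCompletion.of I M) := by
    have := IsPrecomplete.of_forall_exists_sub_sum_pow_smul (M := M) hfg x hx fun i ↦
      exists_forall_sub_sum_pow_smul (x i) (hExt i)
    exact AdicCompletion.of_bijective_iff.mpr {}
  obtain ⟨s, g, hg⟩ := Submodule.fg_iff_exists_fin_generating_family.mp hfg
  replace hg : Ideal.span (Set.range g) = I := hg
  tfae_have 1 → 2 := by
    intro h i F _ _ _ hF
    have := AdicCompletion.of_bijective_iff.mp h
    exact subsingleton_ext_of_isAdicComplete (I := I) i F
      (Ideal.smul_top_eq_top_of_subsingleton_tensorProduct hF)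
  tfae_have 2 → 3 := fun h x hx ↦ h 1 _
    (IsLocalization.flat (Localization.Away x) (Submonoid.powers x))
    (Localization.Away.subsingleton_tensorProduct_quotient (Ideal.le_radical hx))
  tfae_have 3 → 1 := fun h ↦ hcomplete g (by rw [hg]) fun i ↦
    h _ (hg ▸ Ideal.subset_span (Set.mem_range_self i))
  tfae_have 2 → 5 := by
    intro h r x hx
    have hflat (i : Fin r) : Module.Flat R (Localization.Away (x i)) :=
      IsLocalization.flat _ (Submonoid.powers (x i))
    have htensor (i : Fin r) : Subsingleton (Localization.Away (x i) ⊗[R] (R ⧸ I)) :=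
      Localization.Away.subsingleton_tensorProduct_quotient
        (hx.le (Ideal.le_radical (Ideal.subset_span (Set.mem_range_self i))))
    exact h 1 _ inferInstance
      (TensorProduct.directSumLeft R R (fun i ↦ Localization.Away (x i)) (R ⧸ I)).subsingleton
  tfae_have 5 → 4 := fun h ↦ ⟨s, g, by rw [hg], h s g (by rw [hg])⟩
  tfae_have 4 → 1 := by
    rintro ⟨r, x, hx, h⟩
    exact hcomplete x hx fun i ↦ subsingleton_ext_of_retract
      (DirectSum.lof R _ (fun i ↦ Localization.Away (x i)) i) (DirectSum.component R _ _ i)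
      (by ext1; simp) h
  tfae_finish
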